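/- For $n\ge 0$ let $B_n$ be the hyperoctahedral group of signed permutations $\sigma$ of $\{\pm1,\dots,\pm n\}$, $\sigma(-i)=-\sigma(i)$. For $\sigma\in B_n$ let $\mathrm{exc}(\sigma)$, $\mathrm{aexc}(\sigma)$, $\mathrm{fix}(\sigma)$, $\mathrm{st}(\sigma)$, $N(\sigma)$ be the numbers of $i\in[n]=\{1,\dots,n\}$ with $\sigma(|\sigma(i)|)>\sigma(i)$, $\sigma(|\sigma(i)|)<\sigma(i)$, $\sigma(i)=i$, $\sigma(i)=-i$ and $\sigma(i)<0$, respectively, and let $\mathrm{cyc}(\sigma)$ be the number of cycles of $\sigma$, i.e. of the permutation $i\mapsto|\sigma(i)|$ of $[n]$ (fixed points count as cycles). Put $$B_n(x,y,s,t,p,q)=\sum_{\sigma\in B_n}x^{\mathrm{exc}(\sigma)}y^{\mathrm{aexc}(\sigma)}s^{\mathrm{fix}(\sigma)}t^{\mathrm{st}(\sigma)}p^{\mathrm{cyc}(\sigma)}q^{N(\sigma)}.$$ **Theorem 2.3.** (i) As formal power series in $z$ (for $x,y,s,t,p,q$ in any field of characteristic $0$ with $x\neq y$, in particular for indeterminates;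 $F^p:=\exp(p\log F)$ for a series $F$ with constant term $1$), $$\sum_{n\ge0}B_n(x,y,s,t,p,q)\frac{z^n}{n!}=\left(\frac{(y-x)e^{(s+qt)z}}{ye^{(1+q)xz}-xe^{(1+q)yz}}\right)^p.$$ (ii) There are polynomials $b_{n,i,j}(p)\in\mathbb Z[p]$ $(n\ge0,\ i,j\in\mathbb Z)$ such that for all $n\ge0$ $$B_n(x,y,s,t,p,q)=\sum_{i=0}^n(s+qt)^i(1+q)^{n-i}\sum_{j=0}^{\lfloor (n-i)/2\rfloor}b_{n,i,j}(p)(xy)^j(x+y)^{n-i-2j},$$ and for all $n\ge 0$ and all integers $i,j$ $$b_{n+1,i,j}(p)=p\,b_{n,i-1,j}(p)+(1+i)b_{n,i+1,j-1}(p)+j\,b_{n,i,j}(p)+2(n-i-2j+2)b_{n,i,j-1}(p),$$ with $b_{0,0,0}(p)=1$ and $b_{0,i,j}(p)=0$ for $(i,j)\ne(0,0)$. Moreover, $$b_{n,i,j}(p)=\sum_{\pi\in\mathfrak S_{n,i,j}}p^{\mathrm{cyc}(\pi)},$$ where $\mathfrak S_{n,i,j}$ is the set of permutations $\pi$ of $[n]$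 with exactly $i$ fixed points, exactly $j$ excedances (indices $k$ with $\pi(k)>k$) and no cycle double ascents (values $v$ with $\pi^{-1}(v)<v<\pi(v)$), and $\mathrm{cyc}(\pi)$ is the number of cycles of $\pi$. In particular $b_{n,i,j}(1)=\#\mathfrak S_{n,i,j}$. -/

import Mathlib

namespace SignedEulerian

/-- The number of cycles of a permutation, fixed points being counted as cycles of length one:
the number of classes of the relation "lying in the same cycle". -/
noncomputable def cyc {n : ℕ} (π : Equiv.Perm (Fin n)) : ℕ :=
  Nat.card (Quotient (Equiv.Perm.SameCycle.setoid π))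

/-- The number of excedances of a permutation: indices `i` with `π(i) > i`. -/
def exc {n : ℕ} (π : Equiv.Perm (Fin n)) : ℕ :=
  (Finset.univ.filter fun i => i < π i).card

/-- The number of fixed points of a permutation. -/
def fix {n : ℕ} (π : Equiv.Perm (Fin n)) : ℕ :=
  (Finset.univ.filter fun i => π i = i).card

/-- The number of cycle double ascents of a permutation: values `x` with
`π⁻¹(x) < x < π(x)`. -/
def cda {n : ℕ} (π : Equiv.Perm (Fin n)) : ℕ :=
  (Finset.univ.filter fun x => π.symm x < x ∧ x < π x).card

/-- The hyperoctahedral group `B_n` as a type. A signed permutation `σ` of `±[n]`, with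
`σ(-i) = -σ(i)`, is given by its one-line notation `σ(1) ⋯ σ(n)`, that is, by the permutation
`i ↦ |σ(i)|` of `[n]` and the sign of each `σ(i)`. The element `k` of `Fin n` stands for
`k + 1 ∈ [n]`. -/
abbrev SignedPerm (n : ℕ) : Type := Equiv.Perm (Fin n) × (Fin n → ℤˣ)

namespace SignedPerm

variable {n : ℕ}

/-- The permutation `i ↦ |σ(i)|` of `[n]`. -/
def absPerm (σ : SignedPerm n) : Equiv.Perm (Fin n) := σ.1

/-- The entry `σ(i) ∈ ±[n]`, as an integer. -/
def entry (σ : SignedPerm n) (i : Fin n) : ℤ := (σ.2 i : ℤ) * (((σ.1 i : ℕ) : ℤ) + 1)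

/-- The number of excedances: `i ∈ [n]` with `σ(|σ(i)|) > σ(i)`. -/
def exc (σ : SignedPerm n) : ℕ :=
  (Finset.univ.filter fun i => σ.entry i < σ.entry (σ.absPerm i)).card

/-- The number of anti-excedances: `i ∈ [n]` with `σ(|σ(i)|) < σ(i)`. -/
def aexc (σ : SignedPerm n) : ℕ :=
  (Finset.univ.filter fun i => σ.entry (σ.absPerm i) < σ.entry i).card

/-- The number of fixed points: `i ∈ [n]` with `σ(i) = i`. -/
def fix (σ : SignedPerm n) : ℕ :=
  (Finset.univ.filter fun i : Fin n => σ.entry i = ((i : ℕ) : ℤ) + 1).card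

/-- The number of singletons: `i ∈ [n]` with `σ(i) = -i`. -/
def st (σ : SignedPerm n) : ℕ :=
  (Finset.univ.filter fun i : Fin n => σ.entry i = -(((i : ℕ) : ℤ) + 1)).card

/-- The number of negative entries. -/
def neg (σ : SignedPerm n) : ℕ :=
  (Finset.univ.filter fun i => σ.entry i < 0).card

/-- The number of cycles in the cycle form of a signed permutation, in which `c` is followed by
`σ(|c|)`; these are the cycles of `i ↦ |σ(i)|`. -/
noncomputable def cyc (σ : SignedPerm n) : ℕ := SignedEulerian.cyc σ.absPerm

end SignedPerm

/-- The polynomial `B_n(x,y,s,t,p,q)`, evaluated at elements of a commutative ring (for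
instance at the variables of a polynomial ring). -/
noncomputable def B {R : Type*} [CommRing R] (n : ℕ) (x y s t p q : R) : R :=
  ∑ σ : SignedPerm n,
    x ^ σ.exc * y ^ σ.aexc * s ^ σ.fix * t ^ σ.st * p ^ σ.cyc * q ^ σ.neg

/-- The set of permutations of `[n]` without cycle double ascents, having `i` fixed points and
`j` excedances. It is empty if `i` or `j` is negative. -/
def permSet (n : ℕ) (i j : ℤ) : Finset (Equiv.Perm (Fin n)) :=
  Finset.univ.filter fun π => cda π = 0 ∧ (fix π : ℤ) = i ∧ (exc π : ℤ) = j

section PowerSeries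

variable {K : Type*} [Field K] [CharZero K]

/-- The formal power series `e^{az}` in the variable `z`. -/
noncomputable def expSeries (a : K) : PowerSeries K :=
  PowerSeries.rescale a (PowerSeries.exp K)

/-- The power `F^p = exp(p log F)` of a formal power series `F` with constant term `1`, the
exponent `p` being any element of the coefficient field. -/
noncomputable def seriesPow (F : PowerSeries K) (p : K) : PowerSeries K :=
  (PowerSeries.exp K).subst (PowerSeries.C p * PowerSeries.logOf F)

/-- The formal power series `(y-x)e^{(s+qt)z} / (y e^{(1+q)xz} - x e^{(1+q)yz})`. The constant
term of the denominator is `y - x`, so that for `x ≠ y` the denominator is invertible. -/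
noncomputable def baseSeries (x y s t q : K) : PowerSeries K :=
  PowerSeries.C (y - x) * expSeries (s + q * t) *
    (PowerSeries.C y * expSeries ((1 + q) * x) - PowerSeries.C x * expSeries ((1 + q) * y))⁻¹

end PowerSeries

end SignedEulerian

namespace SignedEulerian

open Finset Equiv Equiv.Perm

/-! Put k = 1 + q. Fix the signs by value rather than by position, and fix the set S of fixed
points. Conjugation then turns comparisons of signed letters into comparisons in the usual order
(`sum_relabel`), so the signs can be summed out. This leaves a sum over ordinary permutations
(`B_eq_sum_perm`), which is `permPoly` with weights v = k²xy per cycle valley, c = kx per double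
ascent, d = ky per double descent and a = s + qt per fixed point (`B_eq_permPoly`).

Inserting a least element into the cycles gives P_{n+1} = p a P_n + δ P_n for every derivation δ
with δc = δd = δa = v, δv = v(c + d), δp = 0 (`permPoly_succ`). Everything follows from two choices
of δ.

For the expansion, take c, d free. The subalgebra generated by v, c + d, a, p is δ-stable, so P_n
depends on c, d only through c + d, and c may be set to 0 (`permPoly_eq`). Collecting permutations
without double ascents gives the b_{n,i,j}; the same symmetry closes their recurrence
(`gammaCoeff_succ`).

For the generating function, take δ = d/dz on power series. A series U with U(0) = 0 and U' = (kx +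
U)(ky + U) realises the rules by c = kx + U, d = ky + U, a = s + qt + U, v = cd. The base F
satisfies F' = aF, so the n-th derivative of F^p is P_n F^p; its constant term is B_n. -/

/-- The number of cycle valleys of a permutation. -/
def valley {n : ℕ} (π : Perm (Fin n)) : ℕ :=
  (univ.filter fun x => x < π.symm x ∧ x < π x).card

/-- The number of cycle double descents of a permutation. -/
def cdd {n : ℕ} (π : Perm (Fin n)) : ℕ :=
  (univ.filter fun x => x < π.symm x ∧ π x < x).card

/-! ### Inserting a least element into the cycles of a permutation -/

/-- Insert a new least element as a fixed point. -/
def insertFixed {n : ℕ} (e : Perm (Fin n)) : Perm (Fin (n + 1)) := decomposeFin.symm (0, e)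

/-- Insert a new least element just before `b` in its cycle. -/
def insertBefore {n : ℕ} (e : Perm (Fin n)) (b : Fin n) : Perm (Fin (n + 1)) :=
  decomposeFin.symm (b.succ, e)

section Insert

variable {n : ℕ} (e : Perm (Fin n)) (b : Fin n)

@[simp] lemma insertFixed_zero : insertFixed e 0 = 0 := by simp [insertFixed]

@[simp] lemma insertFixed_succ (i : Fin n) : insertFixed e i.succ = (e i).succ := by
  simp [insertFixed]

@[simp] lemma insertFixed_symm_zero : (insertFixed e).symm 0 = 0 := by
  rw [Equiv.symm_apply_eq]; simp

@[simp] lemma insertFixed_symm_succ (i : Fin n) :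
    (insertFixed e).symm i.succ = (e.symm i).succ := by
  rw [Equiv.symm_apply_eq]; simp

@[simp] lemma insertBefore_zero : insertBefore e b 0 = b.succ := by simp [insertBefore]

lemma insertBefore_succ (i : Fin n) :
    insertBefore e b i.succ = if e i = b then 0 else (e i).succ := by
  simp only [insertBefore, decomposeFin_symm_apply_succ]
  split_ifs with h
  · simp [h]
  · rw [swap_apply_of_ne_of_ne (Fin.succ_ne_zero _) (by simpa using h)]

@[simp] lemma insertBefore_symm_zero : (insertBefore e b).symm 0 = (e.symm b).succ := by
  rw [Equiv.symm_apply_eq]; simp [insertBefore_succ]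

lemma insertBefore_symm_succ (i : Fin n) :
    (insertBefore e b).symm i.succ = if i = b then 0 else (e.symm i).succ := by
  rw [Equiv.symm_apply_eq]
  split_ifs with h
  · simp [h]
  · simp [insertBefore_succ, h]

lemma sum_perm_succ {M : Type*} [AddCommMonoid M] (f : Perm (Fin (n + 1)) → M) :
    ∑ σ, f σ = ∑ e : Perm (Fin n), (f (insertFixed e) + ∑ b, f (insertBefore e b)) := by
  rw [← decomposeFin.symm.sum_comp f, Fintype.sum_prod_type_right]
  simp [Fin.sum_univ_succ, insertFixed, insertBefore]

/-! #### Cycles -/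

lemma sameCycle_map_of_step {α β : Type*} [Finite α] {σ : Perm α} {e : Perm β} (f : α → β)
    (h : ∀ w, e.SameCycle (f w) (f (σ w))) {x y : α} (hxy : σ.SameCycle x y) :
    e.SameCycle (f x) (f y) := by
  obtain ⟨k, rfl⟩ := hxy.exists_nat_pow_eq
  clear hxy
  induction k with
  | zero => exact SameCycle.refl _ _
  | succ k ih => rw [pow_succ', mul_apply]; exact ih.trans (h _)

lemma cyc_insertFixed : cyc (insertFixed e) = cyc e + 1 := by
  classical
  have hmap : ∀ x y, e.SameCycle x y → (insertFixed e).SameCycle x.succ y.succ :=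
    fun x y h => sameCycle_map_of_step Fin.succ (fun w => ⟨1, by simp⟩) h
  -- `none` stands for the new cycle formed by 0 alone.
  let f : Option (Quotient (SameCycle.setoid e)) → Quotient (SameCycle.setoid (insertFixed e)) :=
    fun o => o.elim (Quotient.mk _ 0) (Quotient.map Fin.succ hmap)
  have hf : Function.Bijective f := by
    have hs : ∀ x y : Fin (n + 1), (insertFixed e).SameCycle x y →
        Option.map (Quotient.mk (SameCycle.setoid e)) (finSuccEquiv n x) =
          Option.map (Quotient.mk (SameCycle.setoid e)) (finSuccEquiv n y) := by
      intro x y h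
      obtain ⟨k, rfl⟩ := h.exists_nat_pow_eq
      clear h
      induction k with
      | zero => rfl
      | succ k ih =>
        rw [ih, pow_succ', mul_apply]
        generalize (insertFixed e ^ k) x = w
        refine Fin.cases ?_ (fun i => ?_) w
        · simp
        · simpa using Quotient.sound (s := SameCycle.setoid e) ⟨1, by simp⟩
    refine Function.bijective_iff_has_inverse.2
      ⟨Quotient.lift (fun x => Option.map (Quotient.mk _) (finSuccEquiv n x)) hs, ?_, ?_⟩
    · rintro (_ | o)
      · simp [f]
      · induction o using Quotient.inductionOn
        simp [f]
    · intro o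
      induction o using Quotient.inductionOn with | _ x
      refine Fin.cases ?_ (fun i => ?_) x <;> simp [f]
  rw [cyc, ← Nat.card_eq_of_bijective f hf, Finite.card_option, cyc]

lemma cyc_insertBefore : cyc (insertBefore e b) = cyc e := by
  have hmap : ∀ x y, e.SameCycle x y → (insertBefore e b).SameCycle x.succ y.succ := by
    refine fun x y h => sameCycle_map_of_step Fin.succ (fun w => ?_) h
    by_cases hw : e w = b
    -- The arc into b now passes through 0, hence two steps.
    · exact ⟨2, by rw [zpow_ofNat, pow_two]; simp [insertBefore_succ, hw]⟩
    · exact ⟨1, by simp [insertBefore_succ, hw]⟩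
  -- Contracting 0 onto its successor b undoes the insertion up to cycles.
  let r : Fin (n + 1) → Fin n := Fin.cases b id
  have hr : ∀ x y, (insertBefore e b).SameCycle x y → e.SameCycle (r x) (r y) := by
    refine fun x y h => sameCycle_map_of_step r (fun w => ?_) h
    refine Fin.cases ?_ (fun i => ?_) w
    · simpa [r] using SameCycle.refl _ _
    · refine ⟨1, ?_⟩
      by_cases hw : e i = b <;> simp [insertBefore_succ, hw, r]
  refine Nat.card_congr (Equiv.mk (Quotient.map r hr) (Quotient.map Fin.succ hmap) ?_ ?_)
  · intro o
    induction o using Quotient.inductionOn with | _ x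
    refine Quotient.sound ?_
    refine Fin.cases ?_ (fun i => ?_) x
    · exact SameCycle.symm ⟨1, by simp [r]⟩
    · exact SameCycle.refl _ _
  · intro o
    induction o using Quotient.inductionOn with | _ x
    rfl

/-! #### Fixed points, valleys, double ascents and double descents -/

lemma card_filter_fin_succ (P : Fin (n + 1) → Prop) [DecidablePred P] :
    (univ.filter P).card = (if P 0 then 1 else 0) + (univ.filter fun i : Fin n => P i.succ).card := by
  rw [card_filter, Fin.sum_univ_succ, card_filter]

lemma card_filter_succ_of_iff {α : Type*} [Fintype α] {P Q : α → Prop} [DecidablePred P]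
    [DecidablePred Q] (k : α) (hk : P k) (hk' : ¬ Q k) (h : ∀ i, i ≠ k → (P i ↔ Q i)) :
    (univ.filter P).card = (univ.filter Q).card + 1 := by
  classical
  rw [← card_insert_of_notMem (a := k) (s := univ.filter Q) (by simpa using hk')]
  congr 1
  ext i
  by_cases hi : i = k
  · simp [hi, hk]
  · simp [hi, h i hi]

lemma card_filter_of_iff {α : Type*} [Fintype α] {P Q : α → Prop} [DecidablePred P]
    [DecidablePred Q] (h : ∀ i, P i ↔ Q i) : (univ.filter P).card = (univ.filter Q).card := by
  congr 1; ext i; simp [h i]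

lemma stats_insertFixed : fix (insertFixed e) = fix e + 1 ∧ valley (insertFixed e) = valley e ∧
    cda (insertFixed e) = cda e ∧ cdd (insertFixed e) = cdd e := by
  simp [fix, valley, cda, cdd, card_filter_fin_succ, add_comm]

/-- The statistics of `insertBefore e b`, one position at a time. -/
lemma stats_insertBefore :
    fix (insertBefore e b) = (univ.filter fun i => i ≠ b ∧ e i = i).card ∧
    valley (insertBefore e b) =
      (univ.filter fun i => (i ≠ b ∧ i < e.symm i) ∧ (e i ≠ b ∧ i < e i)).card + 1 ∧
    cda (insertBefore e b) =
      (univ.filter fun i => (i = b ∨ e.symm i < i) ∧ (e i ≠ b ∧ i < e i)).card ∧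
    cdd (insertBefore e b) =
      (univ.filter fun i => (i ≠ b ∧ i < e.symm i) ∧ (e i = b ∨ e i < i)).card := by
  have h1 : ∀ i : Fin n, insertBefore e b i.succ = i.succ ↔ i ≠ b ∧ e i = i := by
    intro i
    rw [insertBefore_succ]
    split_ifs with h
    · simp only [(Fin.succ_ne_zero i).symm, false_iff]; grind
    · simp only [Fin.succ_inj]; grind
  have h2 : ∀ i : Fin n, i.succ < (insertBefore e b).symm i.succ ↔ i ≠ b ∧ i < e.symm i := by
    intro i; rw [insertBefore_symm_succ]; split_ifs with h <;> simp [h]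
  have h3 : ∀ i : Fin n, i.succ < insertBefore e b i.succ ↔ e i ≠ b ∧ i < e i := by
    intro i; rw [insertBefore_succ]; split_ifs with h <;> simp [h]
  have h4 : ∀ i : Fin n, (insertBefore e b).symm i.succ < i.succ ↔ i = b ∨ e.symm i < i := by
    intro i; rw [insertBefore_symm_succ]; split_ifs with h <;> simp [h]
  have h5 : ∀ i : Fin n, insertBefore e b i.succ < i.succ ↔ e i = b ∨ e i < i := by
    intro i; rw [insertBefore_succ]; split_ifs with h <;> simp [h]
  simp [fix, valley, cda, cdd, card_filter_fin_succ, h1, h2, h3, h4, h5, add_comm]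

variable {e b}

/-- The loop at b becomes a 2-cycle through 0, which is its valley; b becomes a peak. -/
lemma stats_insertBefore_fixed (h : e b = b) :
    fix e = fix (insertBefore e b) + 1 ∧ valley (insertBefore e b) = valley e + 1 ∧
    cda (insertBefore e b) = cda e ∧ cdd (insertBefore e b) = cdd e := by
  obtain ⟨h1, h2, h3, h4⟩ := stats_insertBefore e b
  have hb : e.symm b = b := by rw [symm_apply_eq, h]
  have inj : ∀ i, e i = b ↔ i = b := fun i => by rw [← Equiv.eq_symm_apply, hb]
  rw [h1, h2, h3, h4]
  refine ⟨card_filter_succ_of_iff b h (by simp) (by simp +contextual), ?_, ?_, ?_⟩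
  · rw [valley]; congr 1; refine card_filter_of_iff fun i => ?_
    grind
  all_goals
    refine card_filter_of_iff fun i => ?_
    by_cases hi : i = b
    · subst hi; simp [h, hb]
    · simp [hi, inj]

/-- Insertion in the ascending arc leaving a valley a: 0 takes over as valley and a becomes a double
descent. -/
lemma stats_insertBefore_valley {a : Fin n} (h : a < e.symm a ∧ a < e a) :
    fix (insertBefore e (e a)) = fix e ∧ valley (insertBefore e (e a)) = valley e ∧
    cda (insertBefore e (e a)) = cda e ∧ cdd (insertBefore e (e a)) = cdd e + 1 := by
  obtain ⟨h1, h2, h3, h4⟩ := stats_insertBefore e (e a)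
  rw [h1, h2, h3, h4]
  have hs : e.symm (e a) = a := by simp
  have inj : ∀ i, e i = e a ↔ i = a := fun i => e.injective.eq_iff
  refine ⟨card_filter_of_iff fun i => ?_, (card_filter_succ_of_iff a ?_ ?_ fun i hi => ?_).symm,
    card_filter_of_iff fun i => ?_, card_filter_succ_of_iff a ?_ ?_ fun i hi => ?_⟩ <;> grind

lemma stats_insertBefore_cda {a : Fin n} (h : e.symm a < a ∧ a < e a) :
    fix (insertBefore e (e a)) = fix e ∧ valley (insertBefore e (e a)) = valley e + 1 ∧
    cda e = cda (insertBefore e (e a)) + 1 ∧ cdd (insertBefore e (e a)) = cdd e := by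
  obtain ⟨h1, h2, h3, h4⟩ := stats_insertBefore e (e a)
  rw [h1, h2, h3, h4]
  have hs : e.symm (e a) = a := by simp
  have inj : ∀ i, e i = e a ↔ i = a := fun i => e.injective.eq_iff
  refine ⟨card_filter_of_iff fun i => ?_, congrArg (· + 1) (card_filter_of_iff fun i => ?_),
    card_filter_succ_of_iff a ?_ ?_ fun i hi => ?_, card_filter_of_iff fun i => ?_⟩ <;> grind

lemma stats_insertBefore_desc_valley (h : b < e.symm b ∧ b < e b) :
    fix (insertBefore e b) = fix e ∧ valley (insertBefore e b) = valley e ∧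
    cda (insertBefore e b) = cda e + 1 ∧ cdd (insertBefore e b) = cdd e := by
  obtain ⟨h1, h2, h3, h4⟩ := stats_insertBefore e b
  rw [h1, h2, h3, h4]
  have inj : ∀ i, e i = b ↔ i = e.symm b := fun i => (Equiv.eq_symm_apply e).symm
  have hs : e (e.symm b) = b := by simp
  refine ⟨card_filter_of_iff fun i => ?_, (card_filter_succ_of_iff b ?_ ?_ fun i hi => ?_).symm,
    card_filter_succ_of_iff b ?_ ?_ fun i hi => ?_, card_filter_of_iff fun i => ?_⟩ <;> grind

lemma stats_insertBefore_cdd (h : b < e.symm b ∧ e b < b) :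
    fix (insertBefore e b) = fix e ∧ valley (insertBefore e b) = valley e + 1 ∧
    cda (insertBefore e b) = cda e ∧ cdd e = cdd (insertBefore e b) + 1 := by
  obtain ⟨h1, h2, h3, h4⟩ := stats_insertBefore e b
  rw [h1, h2, h3, h4]
  have inj : ∀ i, e i = b ↔ i = e.symm b := fun i => (Equiv.eq_symm_apply e).symm
  have hs : e (e.symm b) = b := by simp
  refine ⟨card_filter_of_iff fun i => ?_, congrArg (· + 1) (card_filter_of_iff fun i => ?_),
    card_filter_of_iff fun i => ?_, card_filter_succ_of_iff b ?_ ?_ fun i hi => ?_⟩ <;> grind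

end Insert

/-- The statistics `fix`, `valley`, `cda`, `cdd`, `cyc` under insertion of a least element. -/
lemma sum_stats_perm_succ {M : Type*} [AddCommMonoid M] (n : ℕ) (Φ : ℕ → ℕ → ℕ → ℕ → ℕ → M) :
    ∑ σ : Perm (Fin (n + 1)), Φ (fix σ) (valley σ) (cda σ) (cdd σ) (cyc σ) =
      ∑ e : Perm (Fin n), (Φ (fix e + 1) (valley e) (cda e) (cdd e) (cyc e + 1) +
        (fix e • Φ (fix e - 1) (valley e + 1) (cda e) (cdd e) (cyc e) +
        valley e • Φ (fix e) (valley e) (cda e) (cdd e + 1) (cyc e) +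
        cda e • Φ (fix e) (valley e + 1) (cda e - 1) (cdd e) (cyc e) +
        valley e • Φ (fix e) (valley e) (cda e + 1) (cdd e) (cyc e) +
        cdd e • Φ (fix e) (valley e + 1) (cda e) (cdd e - 1) (cyc e))) := by
  rw [sum_perm_succ]
  refine sum_congr rfl fun e _ => ?_
  obtain ⟨h1, h2, h3, h4⟩ := stats_insertFixed e
  rw [h1, h2, h3, h4, cyc_insertFixed]
  congr 1
  set c := cyc e
  -- Each non-loop arc is charged to its smaller end: ascending arcs to their source a (in `g`),
  -- descending arcs to their target b (in `h`, with the loops). A valley is charged twice. The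
  -- truncated subtractions occur only where the statistic is positive.
  let g : Fin n → M := fun a =>
    (if a < e.symm a ∧ a < e a then Φ (fix e) (valley e) (cda e) (cdd e + 1) c else 0) +
    (if e.symm a < a ∧ a < e a then Φ (fix e) (valley e + 1) (cda e - 1) (cdd e) c else 0)
  let h : Fin n → M := fun b =>
    (if e b = b then Φ (fix e - 1) (valley e + 1) (cda e) (cdd e) c else 0) +
    (if b < e.symm b ∧ b < e b then Φ (fix e) (valley e) (cda e + 1) (cdd e) c else 0) +
    (if b < e.symm b ∧ e b < b then Φ (fix e) (valley e + 1) (cda e) (cdd e - 1) c else 0)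
  have key : ∀ b, Φ (fix (insertBefore e b)) (valley (insertBefore e b)) (cda (insertBefore e b))
      (cdd (insertBefore e b)) (cyc (insertBefore e b)) = g (e.symm b) + h b := by
    intro b
    rw [cyc_insertBefore]
    rcases eq_or_ne (e b) b with hb | hb
    · obtain ⟨h1, h2, h3, h4⟩ := stats_insertBefore_fixed hb
      have hb' : e.symm b = b := by rw [symm_apply_eq, hb]
      have : fix (insertBefore e b) = fix e - 1 := by omega
      simp [g, h, hb, hb', this, h2, h3, h4, c]
    · have hs : e.symm b ≠ b := by rw [Ne, symm_apply_eq]; exact hb.symm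
      rcases lt_or_gt_of_ne hs with hlt | hgt
      · obtain ⟨a, rfl⟩ := e.surjective b
        rw [symm_apply_apply] at hlt hs ⊢
        have ha : e.symm a ≠ a := by rw [Ne, symm_apply_eq]; exact hs
        rcases lt_or_gt_of_ne ha with hl | hg
        · obtain ⟨h1, h2, h3, h4⟩ := stats_insertBefore_cda ⟨hl, hlt⟩
          have : cda (insertBefore e (e a)) = cda e - 1 := by omega
          simp [g, h, hb, hl, hl.not_gt, hlt, hlt.not_gt, this, h1, h2, h4, c]
        · obtain ⟨h1, h2, h3, h4⟩ := stats_insertBefore_valley ⟨hg, hlt⟩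
          simp [g, h, hb, hg, hg.not_gt, hlt, hlt.not_gt, h1, h2, h3, h4, c]
      · rcases lt_or_gt_of_ne hb with hl | hg
        · obtain ⟨h1, h2, h3, h4⟩ := stats_insertBefore_cdd ⟨hgt, hl⟩
          have : cdd (insertBefore e b) = cdd e - 1 := by omega
          simp [g, h, hb, hl, hl.not_gt, hgt, hgt.not_gt, this, h1, h2, h3, c]
        · obtain ⟨h1, h2, h3, h4⟩ := stats_insertBefore_desc_valley ⟨hgt, hg⟩
          simp [g, h, hb, hg, hg.not_gt, hgt, hgt.not_gt, h1, h2, h3, h4, c]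
  simp_rw [key, sum_add_distrib]
  rw [e.symm.sum_comp g]
  simp only [g, h, sum_add_distrib, ← sum_filter, sum_const]
  rw [← fix, ← valley, ← cda, ← cdd]
  abel

/-! ### Linear relations between the cycle statistics -/

lemma exc_eq {n : ℕ} (π : Perm (Fin n)) : exc π = valley π + cda π := by
  rw [exc, valley, cda, ← card_union_of_disjoint]
  · congr 1; ext i
    have : i < π i → π.symm i ≠ i := fun h h' => by
      rw [symm_apply_eq] at h'; exact h.ne h'
    simp only [mem_filter, mem_univ, true_and, mem_union]
    grind
  · rw [disjoint_filter]; grind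

lemma card_descents {n : ℕ} (π : Perm (Fin n)) :
    (univ.filter fun x => π x < x).card = valley π + cdd π := by
  have h1 : (univ.filter fun x => π x < x).card = (univ.filter fun x => x < π.symm x).card := by
    refine card_equiv π fun i => ?_
    simp
  rw [h1, valley, cdd, ← card_union_of_disjoint]
  · congr 1; ext i
    have : i < π.symm i → π i ≠ i := fun h h' => by
      rw [← Equiv.eq_symm_apply] at h'; exact h.ne h'
    simp only [mem_filter, mem_univ, true_and, mem_union]
    grind
  · rw [disjoint_filter]; grind

lemma fix_add_exc_add_card_descents {n : ℕ} (π : Perm (Fin n)) :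
    fix π + exc π + (univ.filter fun x => π x < x).card = n := by
  rw [fix, exc, ← card_union_of_disjoint, ← card_union_of_disjoint]
  · conv_rhs => rw [← Fintype.card_fin n, ← card_univ]
    congr 1; ext i
    simp only [mem_filter, mem_univ, true_and, mem_union, iff_true]
    grind
  · rw [← filter_or, disjoint_filter]; grind
  · rw [disjoint_filter]; grind

lemma stats_sum {n : ℕ} (π : Perm (Fin n)) : fix π + 2 * valley π + cda π + cdd π = n := by
  have h1 := fix_add_exc_add_card_descents π
  have h2 := exc_eq π
  have h3 := card_descents π
  omega

/-! ### The derivation rule and cyclic valley hopping -/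

/-- The generating polynomial of permutations by valleys, double ascents, double descents, fixed
points and cycles. -/
noncomputable def permPoly {R : Type*} [CommRing R] (n : ℕ) (v c d a p : R) : R :=
  ∑ π : Perm (Fin n), v ^ valley π * c ^ cda π * d ^ cdd π * a ^ fix π * p ^ cyc π

lemma permPoly_zero {R : Type*} [CommRing R] (v c d a p : R) : permPoly 0 v c d a p = 1 := by
  simp [permPoly, valley, cda, cdd, fix, cyc]

lemma map_permPoly {R S : Type*} [CommRing R] [CommRing S] (f : R →+* S) (n : ℕ)
    (v c d a p : R) : f (permPoly n v c d a p) = permPoly n (f v) (f c) (f d) (f a) (f p) := by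
  simp [permPoly]

/-- A new fixed point contributes p a. The other insertions replace one factor of the monomial as in
the Leibniz rule: a, c or d by v, and v by vc or vd. -/
lemma permPoly_succ {k R : Type*} [CommRing k] [CommRing R] [Algebra k R]
    (δ : Derivation k R R) {v c d a p : R} (hv : δ v = v * (c + d)) (hc : δ c = v) (hd : δ d = v)
    (ha : δ a = v) (hp : δ p = 0) (n : ℕ) :
    permPoly (n + 1) v c d a p =
      p * a * permPoly n v c d a p + δ (permPoly n v c d a p) := by
  rw [permPoly, sum_stats_perm_succ n
    (fun F V C D k => v ^ V * c ^ C * d ^ D * a ^ F * p ^ k), permPoly, map_sum, mul_sum,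
    ← sum_add_distrib]
  refine sum_congr rfl fun e _ => ?_
  have hpow : ∀ (z : R) (m : ℕ), δ (z ^ m) = m * z ^ (m - 1) * δ z := by
    intro z m; simp [Derivation.leibniz_pow, mul_assoc]
  have hV : (valley e : R) * v ^ (valley e - 1) * v = valley e * v ^ valley e := by
    cases valley e <;> simp [pow_succ, mul_assoc]
  simp only [Derivation.leibniz, hpow, smul_eq_mul, hv, hc, hd, ha, hp, nsmul_eq_mul]
  linear_combination (- c ^ cda e * d ^ cdd e * a ^ fix e * p ^ cyc e * (c + d)) * hV

/-- Cyclic valley hopping: double ascents and double descents are equidistributed. -/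
lemma permPoly_eq {R : Type*} [CommRing R] (n : ℕ) (v c d a p : R) :
    permPoly n v c d a p = permPoly n v 0 (c + d) a p := by
  let U := MvPolynomial (Fin 5) ℤ
  let X : Fin 5 → U := MvPolynomial.X
  let δ : Derivation ℤ U U :=
    MvPolynomial.mkDerivation ℤ ![X 0 * (X 1 + X 2), X 0, X 0, X 0, 0]
  have hδ : ∀ i, δ (X i) = ![X 0 * (X 1 + X 2), X 0, X 0, X 0, 0] i := fun i =>
    MvPolynomial.mkDerivation_X _ _ _
  -- δ(c + d) = 2v, so `T` is stable under δ although it contains neither c nor d separately.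
  let T : Subalgebra ℤ U := Algebra.adjoin ℤ {X 0, X 1 + X 2, X 3, X 4}
  have t0 : X 0 ∈ T := Algebra.subset_adjoin (by simp)
  have t1 : X 1 + X 2 ∈ T := Algebra.subset_adjoin (by simp)
  have t3 : X 3 ∈ T := Algebra.subset_adjoin (by simp)
  have t4 : X 4 ∈ T := Algebra.subset_adjoin (by simp)
  have hT : ∀ u ∈ T, δ u ∈ T := by
    intro u hu
    induction hu using Algebra.adjoin_induction with
    | mem u hu =>
      simp only [Set.mem_insert_iff, Set.mem_singleton_iff] at hu
      rcases hu with rfl | rfl | rfl | rfl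
      · rw [hδ]; exact T.mul_mem t0 t1
      · rw [map_add, hδ, hδ]; exact T.add_mem t0 t0
      · rw [hδ]; exact t0
      · rw [hδ]; exact T.zero_mem
    | algebraMap r => rw [Derivation.map_algebraMap]; exact T.zero_mem
    | add u w _ _ hu hw => rw [map_add]; exact T.add_mem hu hw
    | mul u w hu' hw' hu hw =>
      rw [Derivation.leibniz]
      exact T.add_mem (T.mul_mem hu' hw) (T.mul_mem hw' hu)
  have hQ : permPoly n (X 0) (X 1) (X 2) (X 3) (X 4) ∈ T := by
    induction n with
    | zero => rw [permPoly_zero]; exact T.one_mem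
    | succ n ih =>
      rw [permPoly_succ δ (hδ 0) (hδ 1) (hδ 2) (hδ 3) (hδ 4)]
      exact T.add_mem (T.mul_mem (T.mul_mem t4 t3) ih) (hT _ ih)
  let f : U →ₐ[ℤ] R := MvPolynomial.aeval ![v, c, d, a, p]
  let g : U →ₐ[ℤ] R := MvPolynomial.aeval ![v, 0, c + d, a, p]
  have hf : ∀ i, f (X i) = ![v, c, d, a, p] i := MvPolynomial.aeval_X _
  have hg : ∀ i, g (X i) = ![v, 0, c + d, a, p] i := MvPolynomial.aeval_X _
  have hfg : T ≤ AlgHom.equalizer f g := by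
    refine Algebra.adjoin_le ?_
    rintro u (rfl | rfl | rfl | rfl) <;>
      simp [hf, hg]
  have := hfg hQ
  rw [AlgHom.mem_equalizer] at this
  have e1 := map_permPoly (f : U →+* R) n (X 0) (X 1) (X 2) (X 3) (X 4)
  have e2 := map_permPoly (g : U →+* R) n (X 0) (X 1) (X 2) (X 3) (X 4)
  simp only [AlgHom.coe_toRingHom, hf, hg] at e1 e2
  exact e1.symm.trans (this.trans e2)

/-- Extracting the terms of degree one in the variable marking double ascents. -/
lemma sum_cda_eq_one {R : Type*} [CommRing R] (n : ℕ) (v a p : R) :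
    ∑ π : Perm (Fin n), (if cda π = 1 then v ^ valley π * a ^ fix π * p ^ cyc π else 0) =
      ∑ π : Perm (Fin n),
        (if cda π = 0 then (cdd π : R) * (v ^ valley π * a ^ fix π * p ^ cyc π) else 0) := by
  -- With d = 1 and c the variable, the right side carries (c + 1)^cdd on permutations without
  -- double ascents; its linear coefficient is cdd.
  have h := congrArg (fun f => Polynomial.coeff f 1)
    (permPoly_eq n (Polynomial.C v) Polynomial.X 1 (Polynomial.C a) (Polynomial.C p))
  simp only [permPoly, Polynomial.finsetSum_coeff] at h
  convert h using 2 with π _ π _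
  · have : Polynomial.C v ^ valley π * Polynomial.X ^ cda π * 1 ^ cdd π * Polynomial.C a ^ fix π *
        Polynomial.C p ^ cyc π =
        Polynomial.C (v ^ valley π * a ^ fix π * p ^ cyc π) * Polynomial.X ^ cda π := by
      simp only [map_mul, map_pow]; ring
    rw [this, Polynomial.coeff_C_mul, Polynomial.coeff_X_pow]
    simp [eq_comm]
  · have : Polynomial.C v ^ valley π * 0 ^ cda π * (Polynomial.X + 1) ^ cdd π *
        Polynomial.C a ^ fix π * Polynomial.C p ^ cyc π =
        Polynomial.C (0 ^ cda π * (v ^ valley π * a ^ fix π * p ^ cyc π)) *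
          (Polynomial.X + 1) ^ cdd π := by
      simp only [map_mul, map_pow, map_zero]; ring
    rw [this, Polynomial.coeff_C_mul, Polynomial.coeff_X_add_one_pow]
    by_cases h0 : cda π = 0
    · simp [h0, mul_comm]
    · simp [h0]

lemma sum_cda_eq_one_of_stats {R : Type*} [CommRing R] (n : ℕ) (p : R) (i j : ℕ) :
    ∑ π : Perm (Fin n), (if cda π = 1 ∧ fix π = i ∧ valley π = j then p ^ cyc π else 0) =
      ∑ π : Perm (Fin n),
        (if cda π = 0 ∧ fix π = i ∧ valley π = j then (cdd π : R) * p ^ cyc π else 0) := by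
  have h := congrArg (fun f => Polynomial.coeff (Polynomial.coeff f j) i)
    (sum_cda_eq_one n (Polynomial.X : Polynomial (Polynomial R)) (Polynomial.C Polynomial.X)
      (Polynomial.C (Polynomial.C p)))
  simp only [Polynomial.finsetSum_coeff] at h
  have key : ∀ π : Perm (Fin n), ((Polynomial.X : Polynomial (Polynomial R)) ^ valley π *
      Polynomial.C Polynomial.X ^ fix π * Polynomial.C (Polynomial.C p) ^ cyc π) =
      Polynomial.C (Polynomial.C (p ^ cyc π) * Polynomial.X ^ fix π) *
        Polynomial.X ^ valley π := by
    intro π; simp only [map_mul, map_pow]; ring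
  have coeff_eq : ∀ (r : R) (F V : ℕ), Polynomial.coeff (Polynomial.coeff
      (Polynomial.C (Polynomial.C r * Polynomial.X ^ F) * Polynomial.X ^ V) j) i =
      if F = i ∧ V = j then r else 0 := by
    intro r F V
    rw [Polynomial.coeff_C_mul, Polynomial.coeff_X_pow]
    by_cases hV : V = j
    · rw [if_pos hV.symm, mul_one, Polynomial.coeff_C_mul, Polynomial.coeff_X_pow]
      simp [hV, eq_comm]
    · rw [if_neg (Ne.symm hV), mul_zero, Polynomial.coeff_zero, if_neg (by tauto)]
  convert h using 2 with π _ π _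
  · rw [key]
    split_ifs with h1 h2 h2
    · rw [coeff_eq, if_pos h1.2]
    · tauto
    · rw [coeff_eq, if_neg (by tauto)]
    · simp
  · have : (cdd π : Polynomial (Polynomial R)) = Polynomial.C (Polynomial.C (cdd π : R)) := by simp
    rw [key, this, ← mul_assoc, ← map_mul, ← mul_assoc, ← map_mul]
    split_ifs with h1 h2 h2
    · rw [coeff_eq, if_pos h1.2]
    · tauto
    · rw [coeff_eq, if_neg (by tauto)]
    · simp

/-! ### The coefficients b and their recurrence -/

/-- The coefficient polynomials `b_{n,i,j}`. -/
noncomputable def gammaCoeff (n : ℕ) (i j : ℤ) : Polynomial ℤ :=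
  ∑ π ∈ permSet n i j, Polynomial.X ^ cyc π

lemma gammaCoeff_eq (n : ℕ) (i j : ℤ) :
    gammaCoeff n i j = ∑ π : Perm (Fin n),
      (if cda π = 0 ∧ (fix π : ℤ) = i ∧ (valley π : ℤ) = j then Polynomial.X ^ cyc π else 0) := by
  rw [gammaCoeff, permSet, sum_filter]
  refine sum_congr rfl fun π _ => ?_
  congr 1
  rw [exc_eq]
  by_cases h : cda π = 0 <;> simp [h]

lemma gammaCoeff_zero (i j : ℤ) : gammaCoeff 0 i j = if i = 0 ∧ j = 0 then 1 else 0 := by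
  rw [gammaCoeff_eq]
  simp [cda, fix, valley, cyc, eq_comm]

lemma sum_cdd_mul (n : ℕ) (i j : ℤ) :
    ∑ π : Perm (Fin n), (if cda π = 0 ∧ (fix π : ℤ) = i ∧ (valley π : ℤ) = j then
      (cdd π : Polynomial ℤ) * Polynomial.X ^ cyc π else 0) =
      (((n : ℤ) - i - 2 * j : ℤ) : Polynomial ℤ) * gammaCoeff n i j := by
  rw [gammaCoeff_eq, mul_sum]
  refine sum_congr rfl fun π _ => ?_
  split_ifs with h
  · have : ((n : ℤ) - i - 2 * j) = cdd π := by have := stats_sum π; omega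
    rw [this, Int.cast_natCast]
  · simp

lemma sum_cda_eq_one_of_stats_int (n : ℕ) (i j : ℤ) :
    ∑ π : Perm (Fin n), (if cda π = 1 ∧ (fix π : ℤ) = i ∧ (valley π : ℤ) = j then
      (Polynomial.X : Polynomial ℤ) ^ cyc π else 0) =
      (((n : ℤ) - i - 2 * j : ℤ) : Polynomial ℤ) * gammaCoeff n i j := by
  rw [← sum_cdd_mul]
  by_cases h : 0 ≤ i ∧ 0 ≤ j
  · obtain ⟨⟨i, rfl⟩, ⟨j, rfl⟩⟩ :=
      And.intro (Int.eq_ofNat_of_zero_le h.1) (Int.eq_ofNat_of_zero_le h.2)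
    simpa using sum_cda_eq_one_of_stats n (Polynomial.X : Polynomial ℤ) i j
  · rw [sum_eq_zero, sum_eq_zero] <;>
    · intro π _
      rw [if_neg]
      omega

/-- Besides permutations without double ascents, insertion also uses those with exactly one, which
it destroys. Valley hopping trades these for double descents, of which there are n - i - 2(j - 1);
this doubles the last coefficient. -/
lemma gammaCoeff_succ (n : ℕ) (i j : ℤ) :
    gammaCoeff (n + 1) i j =
      Polynomial.X * gammaCoeff n (i - 1) j +
        ((1 + i : ℤ) : Polynomial ℤ) * gammaCoeff n (i + 1) (j - 1) +
        (j : Polynomial ℤ) * gammaCoeff n i j +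
        ((2 * ((n : ℤ) - i - 2 * j + 2) : ℤ) : Polynomial ℤ) * gammaCoeff n i (j - 1) := by
  have e2 : ((2 * ((n : ℤ) - i - 2 * j + 2) : ℤ) : Polynomial ℤ) * gammaCoeff n i (j - 1) =
      (((n : ℤ) - i - 2 * (j - 1) : ℤ) : Polynomial ℤ) * gammaCoeff n i (j - 1) +
      (((n : ℤ) - i - 2 * (j - 1) : ℤ) : Polynomial ℤ) * gammaCoeff n i (j - 1) := by
    push_cast; ring
  rw [e2]
  nth_rw 1 [← sum_cda_eq_one_of_stats_int]
  rw [← sum_cdd_mul]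
  simp only [gammaCoeff_eq]
  rw [sum_stats_perm_succ n (fun F V C _ k =>
    if C = 0 ∧ (F : ℤ) = i ∧ (V : ℤ) = j then (Polynomial.X : Polynomial ℤ) ^ k else 0)]
  simp only [mul_sum, ← sum_add_distrib]
  refine sum_congr rfl fun e _ => ?_
  have t1 : (if cda e = 0 ∧ ((fix e + 1 : ℕ) : ℤ) = i ∧ (valley e : ℤ) = j then
      (Polynomial.X : Polynomial ℤ) ^ (cyc e + 1) else 0) = Polynomial.X *
      (if cda e = 0 ∧ (fix e : ℤ) = i - 1 ∧ (valley e : ℤ) = j then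
        (Polynomial.X : Polynomial ℤ) ^ cyc e else 0) := by
    rw [mul_ite, mul_zero, pow_succ']
    congr 1
    apply propext; constructor <;> intro h <;> omega
  have t2 : fix e • (if cda e = 0 ∧ ((fix e - 1 : ℕ) : ℤ) = i ∧ ((valley e + 1 : ℕ) : ℤ) = j then
      (Polynomial.X : Polynomial ℤ) ^ cyc e else 0) = ((1 + i : ℤ) : Polynomial ℤ) *
      (if cda e = 0 ∧ (fix e : ℤ) = i + 1 ∧ (valley e : ℤ) = j - 1 then
        (Polynomial.X : Polynomial ℤ) ^ cyc e else 0) := by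
    -- Without fixed points the left multiplicity is 0; on the right the condition forces i = -1,
    -- where 1 + i vanishes.
    rcases Nat.eq_zero_or_pos (fix e) with h | h
    · rw [h, zero_smul]
      split_ifs with h'
      · have : 1 + i = 0 := by omega
        simp [this]
      · simp
    · split_ifs with h1 h2 h2
      · have : 1 + i = fix e := by omega
        rw [this]; simp
      · omega
      · omega
      · simp
  have t3 : valley e • (if cda e = 0 ∧ (fix e : ℤ) = i ∧ (valley e : ℤ) = j then
      (Polynomial.X : Polynomial ℤ) ^ cyc e else 0) = (j : Polynomial ℤ) *
      (if cda e = 0 ∧ (fix e : ℤ) = i ∧ (valley e : ℤ) = j then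
        (Polynomial.X : Polynomial ℤ) ^ cyc e else 0) := by
    split_ifs with h1
    · rw [← h1.2.2]; simp
    · simp
  have t4 : cda e • (if cda e - 1 = 0 ∧ (fix e : ℤ) = i ∧ ((valley e + 1 : ℕ) : ℤ) = j then
      (Polynomial.X : Polynomial ℤ) ^ cyc e else 0) =
      (if cda e = 1 ∧ (fix e : ℤ) = i ∧ (valley e : ℤ) = j - 1 then
        (Polynomial.X : Polynomial ℤ) ^ cyc e else 0) := by
    rcases Nat.eq_zero_or_pos (cda e) with h | h
    · simp [h]
    · split_ifs with h1 h2 h2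
      · simp [h2.1]
      · omega
      · omega
      · simp
  have t6 : cdd e • (if cda e = 0 ∧ (fix e : ℤ) = i ∧ ((valley e + 1 : ℕ) : ℤ) = j then
      (Polynomial.X : Polynomial ℤ) ^ cyc e else 0) =
      (if cda e = 0 ∧ (fix e : ℤ) = i ∧ (valley e : ℤ) = j - 1 then
        (cdd e : Polynomial ℤ) * Polynomial.X ^ cyc e else 0) := by
    split_ifs with h1 h2 h2
    · simp
    · omega
    · omega
    · simp
  rw [t1, t2, t3, t4, t6]
  simp only [Nat.add_eq_zero_iff, one_ne_zero, and_false, false_and, if_false, smul_zero]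
  ring

lemma permPoly_cda_zero {R : Type*} [CommRing R] (n : ℕ) (v d a p : R) :
    permPoly n v 0 d a p = ∑ i ∈ range (n + 1), a ^ i * ∑ j ∈ range ((n - i) / 2 + 1),
      Polynomial.aeval p (gammaCoeff n i j) * v ^ j * d ^ (n - i - 2 * j) := by
  simp only [gammaCoeff_eq, map_sum, sum_mul, mul_sum]
  rw [permPoly, sum_congr rfl fun i _ => sum_comm, sum_comm]
  refine sum_congr rfl fun π _ => ?_
  have hs := stats_sum π
  by_cases h : cda π = 0
  · rw [sum_eq_single (fix π), sum_eq_single (valley π)]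
    · have : n - fix π - 2 * valley π = cdd π := by omega
      simp [h, this]; ring
    · intro j _ hj
      rw [if_neg (by omega)]; simp
    · intro hj
      exact absurd (mem_range.2 (by omega)) hj
    · intro i _ hi
      refine sum_eq_zero fun j _ => ?_
      rw [if_neg (by omega)]; simp
    · intro hi
      exact absurd (mem_range.2 (by omega)) hi
  · simp [h]

/-! ### Relabelling and summing over signs -/

lemma cyc_conj {n : ℕ} (τ π : Perm (Fin n)) : cyc (τ * π * τ⁻¹) = cyc π := by
  refine (Nat.card_congr (Quotient.congr τ fun x y => ?_)).symm
  change SameCycle π x y ↔ SameCycle (τ * π * τ⁻¹) (τ x) (τ y)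
  rw [sameCycle_conj]
  simp

/-- Two linear orders on the complement of `S` are related by a permutation fixing `S`. -/
lemma exists_perm_lt_iff {n : ℕ} {ℓ : Fin n → ℤ} (hℓ : Function.Injective ℓ)
    (S : Finset (Fin n)) :
    ∃ τ : Perm (Fin n), (∀ v ∈ S, τ v = v) ∧
      ∀ v w, v ∉ S → w ∉ S → (τ v < τ w ↔ ℓ v < ℓ w) := by
  classical
  let A := {v : Fin n // v ∉ S}
  let f : A → ℤ := fun v => ℓ v
  have hf : Function.Injective f := fun v w h => Subtype.ext (hℓ h)
  let g : A ≃ Set.range f := Equiv.ofInjective f hf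
  let o₁ := Fintype.orderIsoFinOfCardEq (Set.range f) (Fintype.card_congr g).symm
  let o₂ := Fintype.orderIsoFinOfCardEq A rfl
  -- Send the element of given rank for ℓ to the element of the same rank in the usual order.
  let ρ : Perm A := (g.trans o₁.symm.toEquiv).trans o₂.toEquiv
  have hρ : ∀ v w : A, ρ v < ρ w ↔ f v < f w := by
    intro v w
    change o₂ (o₁.symm (g v)) < o₂ (o₁.symm (g w)) ↔ _
    rw [o₂.lt_iff_lt, o₁.symm.lt_iff_lt]
    rfl
  refine ⟨ofSubtype ρ, fun v hv => ofSubtype_apply_of_not_mem _ (by simpa using hv), ?_⟩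
  intro v w hv hw
  rw [ofSubtype_apply_of_mem ρ hv, ofSubtype_apply_of_mem ρ hw]
  exact hρ ⟨v, hv⟩ ⟨w, hw⟩

/-- The set of fixed points. -/
def fixSet {n : ℕ} (π : Perm (Fin n)) : Finset (Fin n) := univ.filter fun i => π i = i

/-- The joint distribution of ascents, descents and cycles on permutations with given fixed points
does not depend on the linear order used for comparisons. -/
lemma sum_relabel {R : Type*} [CommRing R] {n : ℕ} {ℓ : Fin n → ℤ} (hℓ : Function.Injective ℓ)
    (S : Finset (Fin n)) (x y p : R) :
    ∑ π : Perm (Fin n) with fixSet π = S, x ^ (univ.filter fun v => ℓ v < ℓ (π v)).card *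
        y ^ (univ.filter fun v => ℓ (π v) < ℓ v).card * p ^ cyc π =
      ∑ π : Perm (Fin n) with fixSet π = S, x ^ exc π * y ^ (univ.filter fun v => π v < v).card *
        p ^ cyc π := by
  obtain ⟨τ, hτ, hlt⟩ := exists_perm_lt_iff hℓ S
  have hτS : ∀ v, τ v ∈ S ↔ v ∈ S := fun v =>
    ⟨fun h => by rwa [τ.injective (hτ _ h)] at h, fun h => by rwa [hτ v h]⟩
  have hfix : ∀ π : Perm (Fin n), fixSet (τ * π * τ⁻¹) = (fixSet π).map τ.toEmbedding := by
    intro π; ext v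
    simp [fixSet, ← Equiv.eq_symm_apply, Equiv.Perm.inv_def]
  have hmap : S.map τ.toEmbedding = S := by
    ext v
    rw [mem_map_equiv, ← hτS, apply_symm_apply]
  refine sum_equiv (MulAut.conj τ).toEquiv (fun π => ?_) fun π hπ => ?_
  · simp only [mem_filter, mem_univ, true_and, MulEquiv.toEquiv_eq_coe, EquivLike.coe_coe,
      MulAut.conj_apply, hfix]
    conv_rhs => rw [← hmap]
    rw [map_inj]
  · have hπ : fixSet π = S := (mem_filter.1 hπ).2
    have hmem : ∀ v, v ∈ S ↔ π v = v := fun v => by rw [← hπ]; simp [fixSet]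
    -- A non-fixed point is compared only with its image, again non-fixed, so order on the
    -- complement of S suffices.
    have hlt' : ∀ v, (τ v < τ (π v) ↔ ℓ v < ℓ (π v)) ∧ (τ (π v) < τ v ↔ ℓ (π v) < ℓ v) := by
      intro v
      by_cases hv : π v = v
      · simp [hv]
      · have h1 : v ∉ S := by rwa [hmem]
        have h2 : π v ∉ S := by rw [hmem]; exact fun h => hv (π.injective h)
        exact ⟨hlt _ _ h1 h2, hlt _ _ h2 h1⟩
    have h1 : (univ.filter fun v => ℓ v < ℓ (π v)).card = exc (τ * π * τ⁻¹) :=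
      card_equiv τ fun v => by rw [mem_filter, mem_filter]; simp [(hlt' v).1]
    have h2 : (univ.filter fun v => ℓ (π v) < ℓ v).card =
        (univ.filter fun v => (τ * π * τ⁻¹) v < v).card :=
      card_equiv τ fun v => by rw [mem_filter, mem_filter]; simp [(hlt' v).2]
    rw [h1, h2, ← cyc_conj τ π]
    rfl

/-- The letter with absolute value `v` in a signed permutation whose letter signs are `δ`. -/
def letter {n : ℕ} (δ : Fin n → ℤˣ) (v : Fin n) : ℤ := (δ v : ℤ) * (((v : ℕ) : ℤ) + 1)

lemma letter_of_one {n : ℕ} {δ : Fin n → ℤˣ} {v : Fin n} (h : δ v = 1) :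
    letter δ v = (v : ℕ) + 1 := by simp [letter, h]

lemma letter_of_neg_one {n : ℕ} {δ : Fin n → ℤˣ} {v : Fin n} (h : δ v = -1) :
    letter δ v = -((v : ℕ) + 1) := by simp [letter, h]

lemma letter_injective {n : ℕ} (δ : Fin n → ℤˣ) : Function.Injective (letter δ) := by
  intro v w h
  ext
  rcases Int.units_eq_one_or (δ v) with hv | hv <;> rcases Int.units_eq_one_or (δ w) with hw | hw <;>
    simp only [letter_of_one, letter_of_neg_one, hv, hw] at h <;> omega

lemma sum_signs {R : Type*} [CommRing R] {n : ℕ} (S : Finset (Fin n)) (s t q : R) :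
    ∑ δ : Fin n → ℤˣ, s ^ (univ.filter fun v => v ∈ S ∧ δ v = 1).card *
        t ^ (univ.filter fun v => v ∈ S ∧ δ v = -1).card *
        q ^ (univ.filter fun v => δ v = -1).card =
      (s + q * t) ^ S.card * (1 + q) ^ (n - S.card) := by
  have h1 : ∀ δ : Fin n → ℤˣ, s ^ (univ.filter fun v => v ∈ S ∧ δ v = 1).card *
        t ^ (univ.filter fun v => v ∈ S ∧ δ v = -1).card *
        q ^ (univ.filter fun v => δ v = -1).card =
      ∏ v, ((if v ∈ S ∧ δ v = 1 then s else 1) * (if v ∈ S ∧ δ v = -1 then t else 1) *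
        (if δ v = -1 then q else 1)) := by
    intro δ
    simp only [prod_mul_distrib, ← prod_filter, prod_const]
  have h2 : (univ : Finset ℤˣ) = {1, -1} := by decide
  have h3 : ∀ v : Fin n, ∑ u : ℤˣ, ((if v ∈ S ∧ u = 1 then s else 1) *
      (if v ∈ S ∧ u = -1 then t else 1) * (if u = -1 then q else 1)) =
      if v ∈ S then s + q * t else 1 + q := by
    intro v
    rw [h2, sum_pair (by decide)]
    have h4 : (1 : ℤˣ) ≠ -1 := by decide
    by_cases hv : v ∈ S <;> simp [hv, h4, h4.symm, mul_comm]
  simp_rw [h1]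
  rw [← Fintype.prod_sum (fun v (u : ℤˣ) => (if v ∈ S ∧ u = 1 then s else 1) *
      (if v ∈ S ∧ u = -1 then t else 1) * (if u = -1 then q else 1))]
  simp_rw [h3]
  rw [prod_ite, prod_const, prod_const]
  simp only [filter_mem_eq_inter, univ_inter, filter_notMem_eq_sdiff]
  rw [card_sdiff_of_subset (subset_univ _), card_univ, Fintype.card_fin]

/-- Composing δ with π attaches signs to values, so the i-th entry is the letter of π i and the
count over positions becomes one over v = π i. -/
lemma stats_signedPerm {n : ℕ} (π : Perm (Fin n)) (δ : Fin n → ℤˣ) :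
    SignedPerm.exc (π, δ ∘ π) = (univ.filter fun v => letter δ v < letter δ (π v)).card ∧
    SignedPerm.aexc (π, δ ∘ π) = (univ.filter fun v => letter δ (π v) < letter δ v).card ∧
    SignedPerm.fix (π, δ ∘ π) = (univ.filter fun v => v ∈ fixSet π ∧ δ v = 1).card ∧
    SignedPerm.st (π, δ ∘ π) = (univ.filter fun v => v ∈ fixSet π ∧ δ v = -1).card ∧
    SignedPerm.neg (π, δ ∘ π) = (univ.filter fun v => δ v = -1).card := by
  have he : ∀ i, SignedPerm.entry (π, δ ∘ π) i = letter δ (π i) := fun i => rfl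
  have h4 : (1 : ℤˣ) ≠ -1 := by decide
  simp only [SignedPerm.exc, SignedPerm.aexc, SignedPerm.fix, SignedPerm.st, SignedPerm.neg, he,
    SignedPerm.absPerm]
  refine ⟨card_equiv π fun i => by simp, card_equiv π fun i => by simp,
    card_equiv π fun i => ?_, card_equiv π fun i => ?_, card_equiv π fun i => ?_⟩ <;>
  simp only [mem_filter, mem_univ, true_and, fixSet, π.injective.eq_iff] <;>
  rcases Int.units_eq_one_or (δ (π i)) with h | h <;>
  simp only [letter_of_one, letter_of_neg_one, h, h4, h4.symm, Fin.ext_iff, and_true, and_false,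
    iff_true, iff_false] <;> omega

/-- Summing over signs turns the signed enumerator into one over ordinary permutations. -/
lemma B_eq_sum_perm {R : Type*} [CommRing R] (n : ℕ) (x y s t p q : R) :
    B n x y s t p q = ∑ π : Perm (Fin n), (s + q * t) ^ fix π * (1 + q) ^ (n - fix π) *
      (x ^ exc π * y ^ (univ.filter fun v => π v < v).card * p ^ cyc π) := by
  let w : Finset (Fin n) → (Fin n → ℤˣ) → R := fun S δ =>
    s ^ (univ.filter fun v => v ∈ S ∧ δ v = 1).card *
        t ^ (univ.filter fun v => v ∈ S ∧ δ v = -1).card *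
        q ^ (univ.filter fun v => δ v = -1).card
  let u : (Fin n → ℤˣ) → Perm (Fin n) → R := fun δ π =>
    x ^ (univ.filter fun v => letter δ v < letter δ (π v)).card *
        y ^ (univ.filter fun v => letter δ (π v) < letter δ v).card * p ^ cyc π
  calc B n x y s t p q = ∑ π : Perm (Fin n), ∑ δ, w (fixSet π) δ * u δ π := by
        rw [B, Fintype.sum_prod_type]
        refine sum_congr rfl fun π _ => ?_
        rw [← (Equiv.arrowCongr π.symm (Equiv.refl ℤˣ)).sum_comp]
        refine sum_congr rfl fun δ _ => ?_
        have : (Equiv.arrowCongr π.symm (Equiv.refl ℤˣ)) δ = δ ∘ π := rfl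
        obtain ⟨h1, h2, h3, h4, h5⟩ := stats_signedPerm π δ
        rw [this, h1, h2, h3, h4, h5, SignedPerm.cyc, SignedPerm.absPerm]
        simp only [w, u]
        ring
    _ = ∑ S, ∑ δ, w S δ * ∑ π : Perm (Fin n) with fixSet π = S, u δ π := by
        rw [← sum_fiberwise _ fixSet]
        refine sum_congr rfl fun S _ => ?_
        simp_rw [mul_sum]
        rw [sum_comm]
        refine sum_congr rfl fun δ _ => sum_congr rfl fun π hπ => ?_
        rw [(mem_filter.1 hπ).2]
    _ = _ := by
        rw [← sum_fiberwise _ fixSet]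
        refine sum_congr rfl fun S _ => ?_
        simp only [u, sum_relabel (letter_injective _)]
        rw [← sum_mul, sum_signs, mul_sum]
        refine sum_congr rfl fun π hπ => ?_
        rw [fix, ← fixSet, (mem_filter.1 hπ).2]

lemma B_eq_permPoly {R : Type*} [CommRing R] (n : ℕ) (x y s t p q : R) :
    B n x y s t p q =
      permPoly n ((1 + q) * x * ((1 + q) * y)) ((1 + q) * x) ((1 + q) * y) (s + q * t) p := by
  rw [B_eq_sum_perm, permPoly]
  refine sum_congr rfl fun π _ => ?_
  have h := stats_sum π
  have h' : n - fix π = 2 * valley π + cda π + cdd π := by omega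
  rw [h', exc_eq, card_descents]
  generalize 1 + q = k
  ring

end SignedEulerian

namespace SignedEulerian

open PowerSeries

/-! ### The exponential generating function -/

section
variable {K : Type*} [Field K] [CharZero K]

lemma constantCoeff_expSeries (a : K) : constantCoeff (expSeries a) = 1 := by
  simp [expSeries, ← coeff_zero_eq_constantCoeff_apply, coeff_rescale]

lemma derivative_expSeries (a : K) : d⁄dX K (expSeries a) = C a * expSeries a := by
  ext n
  simp only [expSeries, coeff_derivative, coeff_rescale, coeff_exp, coeff_C_mul]
  have := congrArg (coeff n) (derivative_exp K)
  rw [coeff_derivative, coeff_exp, coeff_exp] at this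
  rw [← this]; ring

lemma derivative_logOf {F : K⟦X⟧} (hF : constantCoeff F = 1) :
    F * d⁄dX K (logOf F) = d⁄dX K F := by
  have hs : HasSubst (F - 1) := HasSubst.of_constantCoeff_zero' (by simp [hF])
  -- `log K` is log(1 + X), hence the substitution of F - 1 below.
  have h1 : (1 + X : K⟦X⟧) * d⁄dX K (log K) = 1 := by
    ext n
    rw [deriv_log, add_mul, one_mul]
    cases n with
    | zero => simp
    | succ n => simp [coeff_succ_X_mul, coeff_one, pow_succ]
  have h2 := congrArg (subst (F - 1)) h1
  rw [subst_mul hs, subst_add hs, subst_X hs] at h2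
  have h3 : subst (F - 1) (1 : K⟦X⟧) = 1 := by
    rw [← coe_substAlgHom hs, map_one]
  rw [h3, add_sub_cancel] at h2
  rw [logOf_eq, derivative_subst hs, ← mul_assoc, h2, map_sub]
  simp

lemma constantCoeff_seriesPow {F : K⟦X⟧} (hF : constantCoeff F = 1) (p : K) :
    constantCoeff (seriesPow F p) = 1 := by
  have h0 : constantCoeff (C p * logOf F) = 0 := by
    rw [map_mul, constantCoeff_logOf hF, mul_zero]
  have hs : HasSubst (C p * logOf F) := HasSubst.of_constantCoeff_zero' h0
  have : exp K = 1 + (exp K - 1) := by ring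
  have h1 : constantCoeff (subst (C p * logOf F) (exp K - 1)) = 0 :=
    constantCoeff_subst_eq_zero h0 _ (by simp)
  rw [seriesPow, this, subst_add hs, map_add, h1, ← coe_substAlgHom hs, map_one]
  simp

lemma derivative_seriesPow {F H : K⟦X⟧} (hF : constantCoeff F = 1)
    (hH : d⁄dX K F = H * F) (p : K) :
    d⁄dX K (seriesPow F p) = C p * H * seriesPow F p := by
  have h0 : constantCoeff (C p * logOf F) = 0 := by
    rw [map_mul, constantCoeff_logOf hF, mul_zero]
  have hs : HasSubst (C p * logOf F) := HasSubst.of_constantCoeff_zero' h0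
  have hne : F ≠ 0 := by rintro rfl; simp at hF
  have hl : d⁄dX K (logOf F) = H := by
    have := derivative_logOf hF
    rw [hH, mul_comm] at this
    exact mul_right_cancel₀ hne this
  rw [seriesPow, derivative_subst hs, derivative_exp, Derivation.leibniz, hl]
  simp [mul_comm]

/-- The denominator of `baseSeries`. -/
noncomputable def baseDenom (x y k : K) : K⟦X⟧ :=
  C y * expSeries (k * x) - C x * expSeries (k * y)

/-- The power series `k x y (e^{kyz} - e^{kxz}) / (y e^{kxz} - x e^{kyz})`. -/
noncomputable def shiftSeries (x y k : K) : K⟦X⟧ :=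
  C (k * x * y) * (expSeries (k * y) - expSeries (k * x)) * (baseDenom x y k)⁻¹

lemma constantCoeff_baseDenom (x y k : K) : constantCoeff (baseDenom x y k) = y - x := by
  simp [baseDenom, constantCoeff_expSeries]

lemma constantCoeff_shiftSeries (x y k : K) : constantCoeff (shiftSeries x y k) = 0 := by
  simp [shiftSeries, constantCoeff_expSeries]

/-- The series is U = -D'/D for D = `baseDenom x y k`, and D'' = k(x + y)D' - k²xyD; this linear
equation becomes the Riccati equation for U. -/
lemma derivative_shiftSeries {x y : K} (hxy : x ≠ y) (k : K) :
    d⁄dX K (shiftSeries x y k) =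
      (C (k * x) + shiftSeries x y k) * (C (k * y) + shiftSeries x y k) := by
  have hD : constantCoeff (baseDenom x y k) ≠ 0 := by
    rw [constantCoeff_baseDenom]; exact sub_ne_zero.2 hxy.symm
  have h := PowerSeries.mul_inv_cancel _ hD
  simp only [shiftSeries, Derivation.leibniz, derivative_inv', smul_eq_mul, map_sub,
    derivative_expSeries, derivative_C]
  set I := (baseDenom x y k)⁻¹
  have hd : d⁄dX K (baseDenom x y k) =
      C (k * x * y) * (expSeries (k * x) - expSeries (k * y)) := by
    simp only [baseDenom, Derivation.leibniz, smul_eq_mul, map_sub, derivative_expSeries,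
      derivative_C, map_mul]
    ring
  rw [hd]
  rw [baseDenom] at h
  simp only [map_mul] at h ⊢
  generalize expSeries (k * x) = a at *
  generalize expSeries (k * y) = b at *
  generalize C x = x at *
  generalize C y = y at *
  generalize C k = k at *
  linear_combination k ^ 2 * x * y * h

lemma constantCoeff_baseSeries {x y : K} (hxy : x ≠ y) (s t q : K) :
    constantCoeff (baseSeries x y s t q) = 1 := by
  have := constantCoeff_baseDenom x y (1 + q)
  rw [baseDenom] at this
  rw [baseSeries, map_mul, map_mul, constantCoeff_inv, this]
  simp [constantCoeff_expSeries, sub_ne_zero.2 hxy.symm]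

lemma derivative_baseSeries (x y s t q : K) :
    d⁄dX K (baseSeries x y s t q) =
      (C (s + q * t) + shiftSeries x y (1 + q)) * baseSeries x y s t q := by
  have hB : baseSeries x y s t q =
      C (y - x) * expSeries (s + q * t) * (baseDenom x y (1 + q))⁻¹ := rfl
  rw [hB, shiftSeries]
  have hd : d⁄dX K (baseDenom x y (1 + q)) =
      C ((1 + q) * x * y) * (expSeries ((1 + q) * x) - expSeries ((1 + q) * y)) := by
    simp only [baseDenom, Derivation.leibniz, smul_eq_mul, map_sub, derivative_expSeries,
      derivative_C, map_mul]
    ring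
  simp only [Derivation.leibniz, derivative_inv', smul_eq_mul, derivative_expSeries,
    derivative_C, hd]
  ring

lemma iterate_derivative_seriesPow_baseSeries {x y : K} (hxy : x ≠ y) (s t p q : K) (n : ℕ) :
    (d⁄dX K)^[n] (seriesPow (baseSeries x y s t q) p) =
      permPoly n
        ((C ((1 + q) * x) + shiftSeries x y (1 + q)) * (C ((1 + q) * y) + shiftSeries x y (1 + q)))
        (C ((1 + q) * x) + shiftSeries x y (1 + q)) (C ((1 + q) * y) + shiftSeries x y (1 + q))
        (C (s + q * t) + shiftSeries x y (1 + q)) (C p) *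
      seriesPow (baseSeries x y s t q) p := by
  have hU := derivative_shiftSeries hxy (1 + q)
  set U := shiftSeries x y (1 + q)
  have hC : ∀ z : K, d⁄dX K (C z + U) = (C ((1 + q) * x) + U) * (C ((1 + q) * y) + U) := by
    intro z; rw [map_add, derivative_C, zero_add, hU]
  induction n with
  | zero => rw [permPoly_zero, one_mul, Function.iterate_zero, id]
  | succ n ih =>
    rw [Function.iterate_succ_apply', ih, Derivation.leibniz,
      derivative_seriesPow (constantCoeff_baseSeries hxy s t q) (derivative_baseSeries x y s t q),
      permPoly_succ (d⁄dX K) ?_ (hC _) (hC _) (hC _) derivative_C]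
    · simp only [smul_eq_mul]; ring
    · rw [Derivation.leibniz, hC, hC]; simp only [smul_eq_mul]; ring

theorem mk_B_eq_seriesPow {x y : K} (hxy : x ≠ y) (s t p q : K) :
    PowerSeries.mk (fun n => B n x y s t p q / (n.factorial : K)) =
      seriesPow (baseSeries x y s t q) p := by
  ext n
  have h := congrArg constantCoeff (iterate_derivative_seriesPow_baseSeries hxy s t p q n)
  rw [constantCoeff_iterate_derivative, map_mul, map_permPoly,
    constantCoeff_seriesPow (constantCoeff_baseSeries hxy s t q)] at h
  -- At z = 0, U vanishes and the weights become those of `B_eq_permPoly`.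
  simp only [map_mul, map_add, constantCoeff_shiftSeries, add_zero, mul_one] at h
  rw [coeff_mk, B_eq_permPoly, div_eq_iff (Nat.cast_ne_zero.2 n.factorial_ne_zero)]
  simp at h ⊢
  rw [← h]; ring
end
end SignedEulerian

open SignedEulerian in
theorem theorem2p3 :
    (∀ (K : Type*) [Field K] [CharZero K] (x y s t p q : K), x ≠ y →
      PowerSeries.mk (fun n => B n x y s t p q / (n.factorial : K)) =
        seriesPow (baseSeries x y s t q) p) ∧
    ∃ b : ℕ → ℤ → ℤ → Polynomial ℤ,
      (∀ (R : Type*) [CommRing R] (n : ℕ) (x y s t p q : R),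
        B n x y s t p q =
          ∑ i ∈ Finset.range (n + 1), (s + q * t) ^ i * (1 + q) ^ (n - i) *
            ∑ j ∈ Finset.range ((n - i) / 2 + 1),
              Polynomial.aeval p (b n i j) * (x * y) ^ j * (x + y) ^ (n - i - 2 * j)) ∧
      (b 0 0 0 = 1 ∧ ∀ i j : ℤ, (i, j) ≠ (0, 0) → b 0 i j = 0) ∧
      (∀ (n : ℕ) (i j : ℤ),
        b (n + 1) i j =
          Polynomial.X * b n (i - 1) j + ((1 + i : ℤ) : Polynomial ℤ) * b n (i + 1) (j - 1) +
            (j : Polynomial ℤ) * b n i j +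
            ((2 * ((n : ℤ) - i - 2 * j + 2) : ℤ) : Polynomial ℤ) * b n i (j - 1)) ∧
      (∀ (n : ℕ) (i j : ℤ), b n i j = ∑ π ∈ permSet n i j, Polynomial.X ^ cyc π) ∧
      (∀ (n : ℕ) (i j : ℤ), (b n i j).eval 1 = ((permSet n i j).card : ℤ)) := by
  refine ⟨fun K _ _ x y s t p q hxy => mk_B_eq_seriesPow hxy s t p q, gammaCoeff, ?_,
    ⟨by simp [gammaCoeff_zero], fun i j h => ?_⟩, gammaCoeff_succ, fun _ _ _ => rfl,
    fun n i j => by simp [gammaCoeff, Polynomial.eval_finsetSum]⟩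
  · intro R _ n x y s t p q
    rw [B_eq_permPoly, permPoly_eq, permPoly_cda_zero]
    refine Finset.sum_congr rfl fun i hi => ?_
    rw [mul_assoc ((s + q * t) ^ i)]
    congr 1
    rw [Finset.mul_sum]
    refine Finset.sum_congr rfl fun j hj => ?_
    have hi := Finset.mem_range.1 hi
    have hj := Finset.mem_range.1 hj
    -- With k = 1 + q, the factors k^(2j) from v^j and k^m from (kx + ky)^m combine to k^(n-i).
    obtain ⟨m, hm⟩ := Nat.exists_eq_add_of_le (show 2 * j ≤ n - i by omega)
    rw [hm, Nat.add_sub_cancel_left, ← mul_add]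
    generalize x + y = w
    generalize 1 + q = k
    ring
  · rw [gammaCoeff_zero, if_neg]
    rintro ⟨rfl, rfl⟩
    exact h rfl
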